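/- Let $G=(V,E)$ be a finite simple graph with $n\ge 2$ vertices. A labeling of $G$ is a bijection $\sigma\colon V\to\{1,\dots,n\}$, and $\Lambda_G$ is the set of labelings of $G$. For distinct $i,j\in\{1,\dots,n\}$, define the toggle operator $\tau_{i,j}\colon\Lambda_G\to\Lambda_G$ by $\tau_{i,j}(\sigma)=\sigma$ if $\sigma^{-1}(i)$ and $\sigma^{-1}(j)$ are adjacent in $G$, and $\tau_{i,j}(\sigma)=(i\ j)\circ\sigma$ otherwise. Put $\tau_i=\tau_{i,i+1}$ for $1\le i\le n-1$ and $\tau_n=\tau_{n,1}$, and define toric promotion to be the bijection $\mathrm{TPro}=\tau_n\tau_{n-1}\cdots\tau_2\tau_1\colon\Lambda_G\to\Lambda_G$ ($\tau_1$ is applied first). Suppose that $G$ is a forest, let $\sigma\in\Lambda_G$, and let $t$ be the number of vertices in the connected component of $G$ containing $\sigma^{-1}(1)$. Then the orbit of $\sigma$ under $\mathrm{TPro}$ has size $$(n-1)\,\frac{t}{\gcd(t,n)}.$$ In particular, if $G$ is a tree, then every orbit of $\mathrm{TPro}\colon\Lambda_G\to\Lambda_G$ has size $n-1$. -/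

import Mathlib

namespace ToricPromotion

/-- Labelings of a graph on the vertex set `V` with `n` vertices: bijections from `V` to the set of
labels. The label set `{1, …, n}` is represented by `Fin n`; the label `i` is the element
`i - 1` of `Fin n`. -/
abbrev Labeling (V : Type*) (n : ℕ) := V ≃ Fin n

variable {V : Type*} {n : ℕ}

open Classical in
/-- The toggle operator `τ_{i,j}` as a map: it swaps the labels `i` and `j` if they are assigned to
nonadjacent vertices and does nothing otherwise. -/
noncomputable def toggleFun (G : SimpleGraph V) (i j : Fin n) (σ : Labeling V n) : Labeling V n :=
  if G.Adj (σ.symm i) (σ.symm j) then σ else σ.trans (Equiv.swap i j)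

theorem toggleFun_involutive (G : SimpleGraph V) (i j : Fin n) :
    Function.Involutive (toggleFun G i j) := by
  intro σ
  by_cases h : G.Adj (σ.symm i) (σ.symm j)
  · simp [toggleFun, h]
  · have h' : ¬ G.Adj (σ.symm j) (σ.symm i) := fun hh => h hh.symm
    ext v
    simp [toggleFun, h, h']

/-- The toggle operator `τ_{i,j}` as a permutation of the set of labelings. -/
noncomputable def toggle (G : SimpleGraph V) (i j : Fin n) : Equiv.Perm (Labeling V n) :=
  (toggleFun_involutive G i j).toPerm

/-- The toggle operator `τ_i = τ_{i,i+1}`, where the index after the last one is the first one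
(`finRotate n` is the cyclic shift `i ↦ i + 1` of the labels, sending the last label to the
first). -/
noncomputable def cyclicToggle (G : SimpleGraph V) (i : Fin n) : Equiv.Perm (Labeling V n) :=
  toggle G i (finRotate n i)

/-- Toric promotion `TPro = τ_n τ_{n-1} ⋯ τ_2 τ_1`, the rightmost operator being applied first. -/
noncomputable def toricPromotion (G : SimpleGraph V) (n : ℕ) : Equiv.Perm (Labeling V n) :=
  (List.ofFn fun i : Fin n => cyclicToggle G i).reverse.prod

/-- The orbit of a labeling under toric promotion. -/
def toricOrbit (G : SimpleGraph V) (σ : Labeling V n) : Set (Labeling V n) :=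
  {μ | ∃ k : ℤ, (toricPromotion G n ^ k) σ = μ}

end ToricPromotion

/-!
Compose each toggle with the cyclic relabeling that lowers every label by one. All toggles `τ_i`
then become one and the same map, `slide`: toggle the first two labels, then lower all labels.
Since lowering `n` times is the identity, toric promotion is the `n`-th power of `slide`
(`toricPromotion_eq_slide_pow`).

Call the vertex with the first label *active* and let the other `n - 1` vertices sit at `n - 1`
positions around a circle. A slide compares the active vertex with the vertex at the current
position, exchanges the two if they are adjacent, and advances to the next position, which is
cyclic modulo `n - 1`. In a forest, attach to the position of each vertex `v` in the component of
the initially active vertex the edge from `v` to its parent, the tree being rooted at the active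
vertex. An exchange re-roots the tree along one edge and this attachment does not change
(`IsCompatible.step`): the position of an edge always holds the end of the edge that is farther
from the active vertex (`Occupies`), and outside the component nothing moves. So the configuration
is determined by the active vertex and the current position (`IsCompatible.unique`), and a slide
moves the active vertex by the transposition of the ends of the edge at the current position.

A full turn of `n - 1` slides therefore acts on the active vertex as the product of the
transpositions of all edges of a tree on `t` vertices, in some order, and such a product is a cycle
of length `t` (`IsParentMap.sameCycle_prod_swap_iff`). Hence `slide` has period `(n - 1) * t`
(`minimalPeriod_slide`), and its `n`-th power has period
`(n - 1) * t / gcd ((n - 1) * t) n = (n - 1) * (t / gcd t n)`, as `n - 1` and `n` are coprime.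
-/

open Equiv

namespace ToricPromotion

variable {V : Type*}

/-! ### Multiplying a permutation by transpositions -/

/-- Applying `g 0`, then `g 1`, up to `g (m - 1)` is applying the product of these maps in reversed
order. -/
theorem prod_reverse_ofFn_apply {α : Type*} (g : ℕ → Perm α) (z : ℕ → α) (m : ℕ)
    (h : ∀ k < m, z (k + 1) = g k (z k)) :
    (List.ofFn fun i : Fin m => g i).reverse.prod (z 0) = z m := by
  induction m with
  | zero => simp
  | succ m ih =>
    rw [List.ofFn_succ', List.concat_eq_append, List.reverse_append]
    simp only [Fin.val_castSucc, Fin.val_last, List.reverse_cons, List.reverse_nil,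
      List.nil_append, List.cons_append, List.prod_cons, Perm.mul_apply]
    rw [ih fun k hk => h k (by omega), h m (by omega)]

/-- If `a` and `b` lie in different cycles of `f`, then `swap a b * f` follows the cycle of `a` until
`f` would return to `a`, and goes to `b` instead. -/
theorem sameCycle_swap_mul_self [DecidableEq V] [Finite V] {f : Perm V} {a b : V}
    (hab : ¬ f.SameCycle a b) : (swap a b * f).SameCycle a b := by
  have hp : 0 < Function.minimalPeriod f a := by
    rw [Function.minimalPeriod_pos_iff_mem_periodicPts]
    exact f.injective.mem_periodicPts a
  have hpow : ∀ (g : Perm V) (k : ℕ) (x : V), (g ^ k) x = g^[k] x := fun g k x => by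
    rw [Perm.iterate_eq_pow]
  have key : ∀ j < Function.minimalPeriod f a, ((swap a b * f) ^ j) a = (f ^ j) a := by
    intro j
    induction j with
    | zero => simp
    | succ j ih =>
      intro hj
      rw [pow_succ', Perm.mul_apply, ih (by omega), Perm.mul_apply, ← Perm.mul_apply f, ← pow_succ']
      refine swap_apply_of_ne_of_ne (fun h => ?_) (fun h => hab ⟨(j + 1 : ℕ), ?_⟩)
      · rw [hpow] at h
        exact Function.not_isPeriodicPt_of_pos_of_lt_minimalPeriod (by omega) hj h
      · rw [zpow_natCast, h]
  obtain ⟨q, hq⟩ : ∃ q, Function.minimalPeriod f a = q + 1 := ⟨_, (Nat.succ_pred hp.ne').symm⟩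
  refine ⟨(q + 1 : ℕ), ?_⟩
  rw [zpow_natCast, pow_succ', Perm.mul_apply, key q (by omega), Perm.mul_apply,
    ← Perm.mul_apply f, ← pow_succ', ← hq, hpow, Function.iterate_minimalPeriod, swap_apply_left]

/-- Multiplying by a transposition of points in different cycles splits no cycle. -/
theorem SameCycle.swap_mul_of_not_sameCycle [DecidableEq V] [Finite V] {f : Perm V} {a b x y : V}
    (hab : ¬ f.SameCycle a b) (hxy : f.SameCycle x y) : (swap a b * f).SameCycle x y := by
  have hm := sameCycle_swap_mul_self hab
  have step : ∀ z, (swap a b * f).SameCycle z (f z) := by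
    intro z
    have h1 : (swap a b * f).SameCycle z (swap a b (f z)) := ⟨1, by simp⟩
    by_cases ha : f z = a
    · rw [ha, swap_apply_left] at h1
      exact ha ▸ h1.trans hm.symm
    by_cases hb : f z = b
    · rw [hb, swap_apply_right] at h1
      exact hb ▸ h1.trans hm
    rwa [swap_apply_of_ne_of_ne ha hb] at h1
  obtain ⟨k, -, rfl⟩ := hxy.exists_pow_eq'
  clear hxy
  induction k with
  | zero => exact Perm.SameCycle.refl _ _
  | succ k ih => rw [pow_succ', Perm.mul_apply]; exact ih.trans (step _)

theorem ncard_sameCycle {α : Type*} [Finite α] (f : Perm α) (x : α) :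
    {y | f.SameCycle x y}.ncard = Function.minimalPeriod f x := by
  have := Fintype.ofFinite (MulAction.orbit (Subgroup.zpowers f) x)
  change _ = Function.minimalPeriod (f • ·) x
  rw [MulAction.minimalPeriod_eq_card, Fintype.card_eq_nat_card, ← Nat.card_coe_set_eq]
  congr 2
  ext y
  simp [MulAction.mem_orbit_iff, Perm.SameCycle, Subgroup.smul_def]

/-! ### Orienting a forest towards a vertex -/

/-- `par` is a parent map of the graph `G` with root `r`: it sends each vertex `v ≠ r` of the
component of `r` to the next vertex on a shortest path from `v` to `r`, and it fixes the vertices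
outside this component. Of the shortest path only two facts are recorded: the parent is closer to
`r`, and it stays connected to `r` when the edge from `v` to it is removed. The value at `r` is
irrelevant. -/
def IsParentMap (G : SimpleGraph V) (r : V) (par : V → V) : Prop :=
  ∀ v, v ≠ r → (¬ G.Reachable r v ∧ par v = v) ∨
    (G.Adj v (par v) ∧ G.dist r (par v) < G.dist r v ∧
      (G.deleteEdges {s(v, par v)}).Reachable r (par v))

theorem exists_isParentMap (G : SimpleGraph V) (r : V) : ∃ par, IsParentMap G r par := by
  have : ∀ v, ∃ w, v ≠ r → (¬ G.Reachable r v ∧ w = v) ∨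
      (G.Adj v w ∧ G.dist r w < G.dist r v ∧ (G.deleteEdges {s(v, w)}).Reachable r w) := by
    intro v
    by_cases hr : G.Reachable r v
    · obtain ⟨p, hp, hl⟩ := hr.symm.exists_path_of_dist
      cases p with
      | nil => exact ⟨r, fun h => absurd rfl h⟩
      | @cons _ w _ h q =>
        refine ⟨w, fun _ => Or.inr ⟨h, ?_, ?_⟩⟩
        · have := SimpleGraph.dist_le q.reverse
          rw [SimpleGraph.dist_comm (u := r) (v := v), ← hl]
          simp at this ⊢
          omega
        · rw [SimpleGraph.Walk.cons_isPath_iff] at hp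
          refine (q.toDeleteEdge s(v, w) fun he => hp.2 ?_).reachable.symm
          exact q.fst_mem_support_of_mem_edges he
    · exact ⟨v, fun _ => Or.inl ⟨hr, rfl⟩⟩
  exact ⟨fun v => (this v).choose, fun v => (this v).choose_spec⟩

/-- In a forest, every edge is a bridge. -/
theorem not_reachable_deleteEdges {G : SimpleGraph V} (hG : G.IsAcyclic) {u v : V}
    (h : G.Adj u v) : ¬ (G.deleteEdges {s(u, v)}).Reachable u v :=
  SimpleGraph.isBridge_iff.1 (SimpleGraph.isAcyclic_iff_forall_isBridge.1 hG
    (SimpleGraph.mem_edgeSet _ |>.2 h))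

namespace IsParentMap

variable {G : SimpleGraph V} {r : V} {par : V → V}

theorem edge_ne (hpar : IsParentMap G r par) {v w : V} (hv : v ≠ r)
    (hw : w ≠ r) (hvw : v ≠ w) : s(v, par v) ≠ s(w, par w) := by
  intro he
  rcases Sym2.eq_iff.1 he with ⟨h, -⟩ | ⟨h1, h2⟩
  · exact hvw h
  rcases hpar v hv with ⟨-, h⟩ | ⟨ha, hd, -⟩
  · exact hvw (by rw [← h, h2])
  rcases hpar w hw with ⟨-, h⟩ | ⟨ha', hd', -⟩
  · exact hvw (by rw [h1, h])
  rw [h2] at hd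
  rw [← h1] at hd'
  omega

theorem reachable_of_sameCycle_prod_swap [DecidableEq V] [Finite V] {H : SimpleGraph V}
    {l : List V} (hl : ∀ v ∈ l, H.Reachable v (par v)) {x y : V}
    (hxy : (l.map fun u => swap u (par u)).prod.SameCycle x y) : H.Reachable x y := by
  have step : ∀ x, H.Reachable x ((l.map fun u => swap u (par u)).prod x) := by
    clear hxy
    induction l with
    | nil => simp
    | cons u l ih =>
      intro x
      have hu : H.Reachable u (par u) := hl u (by simp)
      refine (ih (fun v hv => hl v (by simp [hv])) x).trans ?_
      rw [List.map_cons, List.prod_cons, Perm.mul_apply]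
      generalize (l.map fun u => swap u (par u)).prod x = z
      rw [swap_apply_def]
      split_ifs with h1 h2
      · exact h1 ▸ hu
      · exact h2 ▸ hu.symm
      · rfl
  obtain ⟨k, -, rfl⟩ := hxy.exists_pow_eq'
  clear hxy
  induction k with
  | zero => exact SimpleGraph.Reachable.refl _
  | succ k ih => rw [pow_succ', Perm.mul_apply]; exact ih.trans (step _)

/-- In a forest, each edge from a vertex to its parent joins two different cycles of the product
of the transpositions of any other such edges, so it merges them, and they stay merged. -/
theorem sameCycle_prod_swap [DecidableEq V] [Finite V] (hG : G.IsAcyclic)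
    (hpar : IsParentMap G r par) {l : List V} (hl : l.Nodup) (hr : r ∉ l) {v : V} (hv : v ∈ l) :
    (l.map fun u => swap u (par u)).prod.SameCycle v (par v) := by
  induction l with
  | nil => simp at hv
  | cons u l ih =>
    rw [List.nodup_cons] at hl
    simp only [List.mem_cons, not_or] at hr hv
    rw [List.map_cons, List.prod_cons]
    rcases hpar u (Ne.symm hr.1) with ⟨-, h⟩ | ⟨ha, -, -⟩
    · rw [h, swap_self, ← Perm.one_def, one_mul]
      rcases hv with rfl | hv
      · rw [h]
      · exact ih hl.2 hr.2 hv
    · have hnot : ¬ (l.map fun u => swap u (par u)).prod.SameCycle u (par u) := by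
        intro hs
        refine not_reachable_deleteEdges hG ha (reachable_of_sameCycle_prod_swap ?_ hs)
        intro w hw
        have hwr : w ≠ r := fun h => hr.2 (h ▸ hw)
        rcases hpar w hwr with ⟨-, h⟩ | ⟨hw', -, -⟩
        · rw [h]
        · refine SimpleGraph.Adj.reachable ?_
          rw [SimpleGraph.deleteEdges_adj]
          exact ⟨hw', hpar.edge_ne hwr (Ne.symm hr.1) fun h => hl.1 (h ▸ hw)⟩
      rcases hv with rfl | hv
      · exact sameCycle_swap_mul_self hnot
      · exact SameCycle.swap_mul_of_not_sameCycle hnot (ih hl.2 hr.2 hv)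

/-- The product of the transpositions of the edges of a tree, in any order, is a cycle through all
vertices of the tree. -/
theorem sameCycle_prod_swap_iff [DecidableEq V] [Finite V] (hG : G.IsAcyclic)
    (hpar : IsParentMap G r par) {l : List V} (hl : l.Nodup) (hmem : ∀ v, v ∈ l ↔ v ≠ r) {v : V} :
    (l.map fun u => swap u (par u)).prod.SameCycle r v ↔ G.Reachable r v := by
  constructor
  · refine reachable_of_sameCycle_prod_swap fun w hw => ?_
    rcases hpar w ((hmem w).1 hw) with ⟨-, h⟩ | ⟨h, -, -⟩
    · rw [h]
    · exact h.reachable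
  · intro h
    generalize hd : G.dist r v = d
    induction d using Nat.strong_induction_on generalizing v with
    | _ d ih =>
      by_cases hv : v = r
      · rw [hv]
      rcases hpar v hv with ⟨h', -⟩ | ⟨ha, hlt, -⟩
      · exact absurd h h'
      · exact (ih _ (hd ▸ hlt) (h.trans ha.reachable) rfl).trans
          (sameCycle_prod_swap hG hpar hl (fun h => (hmem r).1 h rfl) ((hmem v).2 hv)).symm

end IsParentMap

/-! ### Edges as fixed positions -/

/-- The condition on the vertex `x` at the position initially held by `v`, while the vertex `a` is
active. This position is attached to the edge from `v` to its parent, and `x` is the end of this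
edge such that the other end, `y`, stays connected to `a` when the edge is removed. If `v` is its
own parent, then it never leaves its position. -/
def Occupies (G : SimpleGraph V) (par : V → V) (a v x : V) : Prop :=
  (par v = v ∧ x = v) ∨ (G.Adj v (par v) ∧ ∃ y, s(x, y) = s(v, par v) ∧
    (G.deleteEdges {s(v, par v)}).Reachable a y)

namespace Occupies

variable {G : SimpleGraph V} {r : V} {par : V → V}

theorem initial (hpar : IsParentMap G r par) {v : V} (hv : v ≠ r) : Occupies G par r v v := by
  rcases hpar v hv with ⟨-, h⟩ | ⟨ha, -, h⟩
  · exact Or.inl ⟨h, rfl⟩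
  · exact Or.inr ⟨ha, _, rfl, h⟩

/-- Both ends of an edge cannot be the far one, since the edge is a bridge. -/
theorem unique (hG : G.IsAcyclic) {a v x x' : V} (h : Occupies G par a v x)
    (h' : Occupies G par a v x') : x = x' := by
  rcases h with ⟨hv, rfl⟩ | ⟨ha, y, he, hy⟩
  · rcases h' with ⟨-, rfl⟩ | ⟨ha, -⟩
    · rfl
    · exact absurd hv ha.ne'
  rcases h' with ⟨hv, -⟩ | ⟨-, y', he', hy'⟩
  · exact absurd hv ha.ne'
  rcases Sym2.eq_iff.1 (he.trans he'.symm) with ⟨h, -⟩ | ⟨rfl, rfl⟩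
  · exact h
  · rw [← he] at hy hy'
    have : G.Adj x y := by rw [← SimpleGraph.mem_edgeSet, he]; exact ha
    exact absurd (hy'.symm.trans hy) (not_reachable_deleteEdges hG this)

/-- Comparing the active vertex `a` with the vertex `x` at the position of `v` moves `a` by the
transposition along the edge of that position: if `a` and `x` are adjacent, then they are the two
ends of this edge, and otherwise `a` is not an end of it. -/
theorem meet [DecidableEq V] (hG : G.IsAcyclic) (hpar : IsParentMap G r par) {a v x : V}
    (hv : v ≠ r) (hra : G.Reachable r a) (h : Occupies G par a v x) :
    (G.Adj a x → s(a, x) = s(v, par v) ∧ swap v (par v) a = x) ∧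
      (¬ G.Adj a x → swap v (par v) a = a) := by
  rcases h with ⟨hp, rfl⟩ | ⟨ha, y, he, hy⟩
  · refine ⟨fun hax => ?_, fun _ => by rw [hp, swap_self]; rfl⟩
    rcases hpar x hv with ⟨hn, -⟩ | ⟨hx, -, -⟩
    · exact absurd (hra.trans hax.reachable) hn
    · exact absurd hp hx.ne'
  have hxy : G.Adj x y := by rw [← SimpleGraph.mem_edgeSet, he]; exact ha
  have hswap : swap v (par v) = swap x y := by
    rcases Sym2.eq_iff.1 he with ⟨h1, h2⟩ | ⟨h1, h2⟩
    · rw [h1, h2]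
    · rw [h1, h2, swap_comm]
  rw [hswap, ← he]
  rw [← he] at hy
  have hnot := not_reachable_deleteEdges hG hxy
  refine ⟨fun hax => ?_, fun hax => ?_⟩
  · -- Otherwise the edge from `a` to `x` would bypass the bridge between `x` and `y`.
    have : a = y := by
      by_contra hay
      refine hnot (SimpleGraph.Reachable.trans (SimpleGraph.Adj.reachable ?_) hy)
      rw [SimpleGraph.deleteEdges_adj]
      refine ⟨hax.symm, fun h => ?_⟩
      rcases Sym2.eq_iff.1 (Set.mem_singleton_iff.1 h) with ⟨-, h⟩ | ⟨h, -⟩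
      · exact hay h
      · exact hxy.ne h
    rw [this]
    exact ⟨Sym2.eq_swap, swap_apply_right _ _⟩
  · refine swap_apply_of_ne_of_ne ?_ ?_
    · rintro rfl
      exact hnot hy
    · rintro rfl
      exact hax hxy.symm

/-- Moving along one edge does not change which end of another edge is the far one. -/
theorem of_adj {a x v w z : V} (hax : G.Adj a x) (he : s(a, x) = s(v, par v))
    (hne : s(v, par v) ≠ s(w, par w)) (h : Occupies G par a w z) : Occupies G par x w z := by
  rcases h with h | ⟨hw, y, hs, hy⟩
  · exact Or.inl h
  · refine Or.inr ⟨hw, y, hs, SimpleGraph.Reachable.trans (SimpleGraph.Adj.reachable ?_) hy⟩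
    rw [SimpleGraph.deleteEdges_adj, Set.mem_singleton_iff, Sym2.eq_swap, he]
    exact ⟨hax.symm, hne⟩

/-- After moving from `a` to `x`, the far end of the edge between them is `a`. -/
theorem self_of_adj {a x v : V} (hax : G.Adj a x) (he : s(a, x) = s(v, par v)) :
    Occupies G par x v a := by
  refine Or.inr ⟨?_, x, he, SimpleGraph.Reachable.refl _⟩
  rw [← SimpleGraph.mem_edgeSet, ← he]
  exact hax

end Occupies

/-! ### Toric promotion as a power of a single step -/

open scoped Fin.NatCast Fin.CommRing

variable {m : ℕ}

/-- The permutation of the set of labelings that lowers every label by one, cyclically. -/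
def lowerLabels (V : Type*) (n : ℕ) : Perm (Labeling V n) where
  toFun σ := σ.trans (finRotate n).symm
  invFun σ := σ.trans (finRotate n)
  left_inv _ := Equiv.ext fun _ => (finRotate n).apply_symm_apply _
  right_inv _ := Equiv.ext fun _ => (finRotate n).symm_apply_apply _

/-- One step of the motion: toggle the first two labels, then lower all labels by one. The vertex
with the first label is the active one; it either keeps this label, or passes it on to a
neighbor. -/
noncomputable def slide (G : SimpleGraph V) (m : ℕ) : Perm (Labeling V (m + 1)) :=
  lowerLabels V (m + 1) * cyclicToggle G 0

theorem lowerLabels_symm_apply (σ : Labeling V (m + 1)) (i : Fin (m + 1)) :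
    (lowerLabels V (m + 1) σ).symm i = σ.symm (i + 1) := by
  simp [lowerLabels]

theorem lowerLabels_pow_symm_apply (k : ℕ) (σ : Labeling V (m + 1)) (i : Fin (m + 1)) :
    ((lowerLabels V (m + 1) ^ k) σ).symm i = σ.symm (i + k) := by
  induction k generalizing i with
  | zero => simp
  | succ k ih =>
    rw [pow_succ', Perm.mul_apply, lowerLabels_symm_apply, ih]
    push_cast
    congr 1
    abel

theorem lowerLabels_pow_eq_one : lowerLabels V (m + 1) ^ (m + 1) = 1 := by
  ext σ : 1
  refine Equiv.symm_bijective.injective (Equiv.ext fun i => ?_)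
  rw [lowerLabels_pow_symm_apply]
  simp

theorem cyclicToggle_symm_apply (G : SimpleGraph V) (i x : Fin (m + 1))
    (σ : Labeling V (m + 1)) [Decidable (G.Adj (σ.symm i) (σ.symm (i + 1)))] :
    (cyclicToggle G i σ).symm x =
      if G.Adj (σ.symm i) (σ.symm (i + 1)) then σ.symm x else σ.symm (swap i (i + 1) x) := by
  change (toggleFun G i (finRotate (m + 1) i) σ).symm x = _
  rw [finRotate_apply, toggleFun]
  split_ifs <;> simp

/-- Lowering the labels conjugates `τ_{i + 1}` to `τ_i`. -/
theorem lowerLabels_mul_cyclicToggle (G : SimpleGraph V) (i : Fin (m + 1)) :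
    lowerLabels V (m + 1) * cyclicToggle G (i + 1) = cyclicToggle G i * lowerLabels V (m + 1) := by
  classical
  ext σ : 1
  refine Equiv.symm_bijective.injective (Equiv.ext fun x => ?_)
  simp only [Perm.mul_apply, lowerLabels_symm_apply, cyclicToggle_symm_apply]
  split_ifs
  · rfl
  · congr 1
    simp only [swap_apply_def, add_left_inj]
    split_ifs <;> rfl

theorem lowerLabels_pow_mul_cyclicToggle (G : SimpleGraph V) (k : ℕ) :
    lowerLabels V (m + 1) ^ k * cyclicToggle G (k : Fin (m + 1)) =
      cyclicToggle G 0 * lowerLabels V (m + 1) ^ k := by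
  induction k with
  | zero => simp
  | succ k ih =>
    rw [pow_succ, Nat.cast_succ, mul_assoc, lowerLabels_mul_cyclicToggle, ← mul_assoc, ih,
      mul_assoc]

theorem toricPromotion_eq_slide_pow (G : SimpleGraph V) :
    toricPromotion G (m + 1) = slide G m ^ (m + 1) := by
  ext σ : 1
  have h := prod_reverse_ofFn_apply (fun k => cyclicToggle G (k : Fin (m + 1)))
    (fun k => (lowerLabels V (m + 1) ^ k)⁻¹ ((slide G m ^ k) σ)) (m + 1) (by
      intro k _
      rw [Perm.inv_eq_iff_eq, ← Perm.mul_apply, pow_succ' (lowerLabels V (m + 1)), mul_assoc,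
        lowerLabels_pow_mul_cyclicToggle, pow_succ', slide]
      simp)
  simpa [lowerLabels_pow_eq_one, toricPromotion] using h

section slide

variable (G : SimpleGraph V) (σ : Labeling V (m + 1))

theorem slide_symm_zero [Decidable (G.Adj (σ.symm 0) (σ.symm 1))] :
    (slide G m σ).symm 0 =
      if G.Adj (σ.symm 0) (σ.symm 1) then σ.symm 1 else σ.symm 0 := by
  classical
  rw [slide, Perm.mul_apply, lowerLabels_symm_apply, cyclicToggle_symm_apply]
  simp

theorem slide_symm_last [Decidable (G.Adj (σ.symm 0) (σ.symm 1))] :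
    (slide G m σ).symm (m : Fin (m + 1)) =
      if G.Adj (σ.symm 0) (σ.symm 1) then σ.symm 0 else σ.symm 1 := by
  classical
  rw [slide, Perm.mul_apply, lowerLabels_symm_apply, cyclicToggle_symm_apply]
  simp

theorem slide_symm_of_lt {j : ℕ} (hj : j + 1 < m) :
    (slide G m σ).symm ((j + 1 : ℕ) : Fin (m + 1)) = σ.symm ((j + 2 : ℕ) : Fin (m + 1)) := by
  classical
  rw [slide, Perm.mul_apply, lowerLabels_symm_apply, cyclicToggle_symm_apply]
  have h : ((j + 1 : ℕ) : Fin (m + 1)) + 1 = ((j + 2 : ℕ) : Fin (m + 1)) := by push_cast; ring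
  have h0 : ((j + 2 : ℕ) : Fin (m + 1)) ≠ 0 := by
    rw [Ne, Fin.ext_iff, Fin.val_natCast, Nat.mod_eq_of_lt (by omega)]
    simp
  have h1 : ((j + 2 : ℕ) : Fin (m + 1)) ≠ 0 + 1 := by
    rw [← h, Ne, add_left_inj, Fin.ext_iff, Fin.val_natCast, Nat.mod_eq_of_lt (by omega)]
    simp
  rw [h, swap_apply_of_ne_of_ne h0 h1, ite_self]

end slide

/-! ### The motion in a forest -/

/-- The vertex at the `s`-th position of the labeling `σ`. The positions are those of the `m` labels
other than the first one, numbered from `0` and counted cyclically modulo `m`. -/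
def atPosition (σ : Labeling V (m + 1)) (s : ℕ) : V := σ.symm ((s % m + 1 : ℕ) : Fin (m + 1))

theorem natCast_succ_inj {s s' : ℕ} (hs : s < m) (hs' : s' < m)
    (h : ((s + 1 : ℕ) : Fin (m + 1)) = ((s' + 1 : ℕ) : Fin (m + 1))) : s = s' := by
  rw [Fin.ext_iff, Fin.val_natCast, Fin.val_natCast, Nat.mod_eq_of_lt (by omega),
    Nat.mod_eq_of_lt (by omega)] at h
  omega

theorem atPosition_inj (hm : 0 < m) (σ : Labeling V (m + 1)) {s s' : ℕ}
    (h : atPosition σ s = atPosition σ s') : s % m = s' % m :=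
  natCast_succ_inj (Nat.mod_lt _ hm) (Nat.mod_lt _ hm) (σ.symm.injective h)

theorem atPosition_ne (hm : 0 < m) (σ : Labeling V (m + 1)) (s : ℕ) :
    atPosition σ s ≠ σ.symm 0 := by
  intro h
  have h := σ.symm.injective h
  have := Nat.mod_lt s hm
  rw [Fin.ext_iff, Fin.val_natCast, Nat.mod_eq_of_lt (by omega)] at h
  simp at h

theorem atPosition_mod (σ : Labeling V (m + 1)) (s : ℕ) :
    atPosition σ (s % m) = atPosition σ s := by
  rw [atPosition, Nat.mod_mod, atPosition]

theorem exists_atPosition (σ : Labeling V (m + 1)) {v : V} (hv : v ≠ σ.symm 0) :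
    ∃ s < m, atPosition σ s = v := by
  obtain ⟨s, hs⟩ : ∃ s, (σ v : ℕ) = s + 1 := by
    refine Nat.exists_eq_succ_of_ne_zero fun h => hv ?_
    rw [Equiv.eq_symm_apply]
    exact Fin.ext h
  have hlt := (σ v).isLt
  refine ⟨s, by omega, ?_⟩
  rw [atPosition, Nat.mod_eq_of_lt (by omega), Equiv.symm_apply_eq, ← hs, Fin.cast_val_eq_self]

section Forest

variable {G : SimpleGraph V} {σ : Labeling V (m + 1)} {par : V → V}

/-- The labeling `τ` is a configuration that may arise from `σ` after `k` slides: its active vertex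
lies in the component of that of `σ`, and each position holds the vertex prescribed by `Occupies`.
Because the labels are lowered in each slide, the vertex of `τ` with label `j + 1` (as an element of
`Fin (m + 1)`) is at position `j + k` with respect to `σ`. -/
def IsCompatible (G : SimpleGraph V) (σ : Labeling V (m + 1)) (par : V → V) (k : ℕ)
    (τ : Labeling V (m + 1)) : Prop :=
  G.Reachable (σ.symm 0) (τ.symm 0) ∧ ∀ j < m,
    Occupies G par (τ.symm 0) (atPosition σ (j + k)) (τ.symm ((j + 1 : ℕ) : Fin (m + 1)))

theorem IsCompatible.zero (hm : 0 < m) (hpar : IsParentMap G (σ.symm 0) par) :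
    IsCompatible G σ par 0 σ := by
  refine ⟨SimpleGraph.Reachable.refl _, fun j hj => ?_⟩
  have h : σ.symm ((j + 1 : ℕ) : Fin (m + 1)) = atPosition σ (j + 0) := by
    rw [atPosition, add_zero, Nat.mod_eq_of_lt hj]
  rw [h]
  exact Occupies.initial hpar (atPosition_ne hm σ _)

/-- A slide preserves compatibility and moves the active vertex by the transposition along the edge
of the current position. -/
theorem IsCompatible.step [DecidableEq V] (hm : 0 < m) (hG : G.IsAcyclic)
    (hpar : IsParentMap G (σ.symm 0) par) {k : ℕ} {τ : Labeling V (m + 1)}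
    (h : IsCompatible G σ par k τ) :
    IsCompatible G σ par (k + 1) (slide G m τ) ∧
      (slide G m τ).symm 0 = swap (atPosition σ k) (par (atPosition σ k)) (τ.symm 0) := by
  classical
  obtain ⟨hr, ho⟩ := h
  have h0 : Occupies G par (τ.symm 0) (atPosition σ k) (τ.symm 1) := by
    simpa using ho 0 hm
  obtain ⟨hadj, hnadj⟩ := Occupies.meet hG hpar (atPosition_ne hm σ k) hr h0
  -- The inactive one of the two compared vertices gets the last label, and the position of that
  -- label after the slide is the position of the comparison, since `m - 1 + (k + 1)` is `k` modulo `m`.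
  have hlast : ∀ j < m, ¬ j + 1 < m →
      (slide G m τ).symm ((j + 1 : ℕ) : Fin (m + 1)) = (slide G m τ).symm (m : Fin (m + 1)) ∧
      atPosition σ (j + (k + 1)) = atPosition σ k := by
    intro j hj hj'
    obtain rfl : m = j + 1 := by omega
    refine ⟨rfl, ?_⟩
    rw [← atPosition_mod, ← atPosition_mod σ k, show j + (k + 1) = k + (j + 1) by omega,
      Nat.add_mod_right]
  by_cases hax : G.Adj (τ.symm 0) (τ.symm 1)
  · obtain ⟨he, hs⟩ := hadj hax
    have hz := slide_symm_zero G τ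
    rw [if_pos hax] at hz
    refine ⟨⟨?_, fun j hj => ?_⟩, by rw [hs, hz]⟩
    · rw [hz]
      exact hr.trans hax.reachable
    · rw [hz]
      by_cases hj' : j + 1 < m
      · rw [slide_symm_of_lt G τ hj', show j + (k + 1) = j + 1 + k by omega]
        refine Occupies.of_adj hax he (hpar.edge_ne (atPosition_ne hm σ _)
          (atPosition_ne hm σ _) fun h => ?_) (ho (j + 1) hj')
        have := atPosition_inj hm σ h
        have h2 : 0 + k ≡ j + 1 + k [MOD m] := by rw [zero_add]; exact this
        have h3 := Nat.ModEq.add_right_cancel' k h2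
        rw [Nat.ModEq, Nat.zero_mod, Nat.mod_eq_of_lt hj'] at h3
        omega
      · rw [(hlast j hj hj').1, (hlast j hj hj').2, slide_symm_last, if_pos hax]
        exact Occupies.self_of_adj hax he
  · have hz := slide_symm_zero G τ
    rw [if_neg hax] at hz
    refine ⟨⟨by rwa [hz], fun j hj => ?_⟩, by rw [hnadj hax, hz]⟩
    rw [hz]
    by_cases hj' : j + 1 < m
    · rw [slide_symm_of_lt G τ hj', show j + (k + 1) = j + 1 + k by omega]
      exact ho (j + 1) hj'
    · rw [(hlast j hj hj').1, (hlast j hj hj').2, slide_symm_last, if_neg hax]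
      exact h0

theorem isCompatible_slide_pow (hm : 0 < m) (hG : G.IsAcyclic)
    (hpar : IsParentMap G (σ.symm 0) par) (k : ℕ) :
    IsCompatible G σ par k ((slide G m ^ k) σ) := by
  classical
  induction k with
  | zero => exact .zero hm hpar
  | succ k ih => rw [pow_succ', Perm.mul_apply]; exact (ih.step hm hG hpar).1

/-- The active vertex and the shift of the positions determine a compatible configuration. -/
theorem IsCompatible.unique (hG : G.IsAcyclic) {k k' : ℕ} (hk : k ≡ k' [MOD m])
    {τ τ' : Labeling V (m + 1)} (h : IsCompatible G σ par k τ) (h' : IsCompatible G σ par k' τ')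
    (h0 : τ.symm 0 = τ'.symm 0) : τ = τ' := by
  refine Equiv.symm_bijective.injective (Equiv.ext fun i => ?_)
  rcases Fin.eq_zero_or_eq_succ i with rfl | ⟨j, rfl⟩
  · exact h0
  · have hj : ((j + 1 : ℕ) : Fin (m + 1)) = j.succ := by ext; simp
    have h1 := h.2 j j.isLt
    have h2 := h'.2 j j.isLt
    rw [← h0, ← atPosition_mod, ← (hk.add_left (j : ℕ) : (j + k) % m = (j + k') % m),
      atPosition_mod] at h2
    rw [← hj]
    exact h1.unique hG h2

/-- The product of the transpositions along the edges in one full turn through all positions. -/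
def turn [DecidableEq V] (σ : Labeling V (m + 1)) (par : V → V) : Perm V :=
  (List.ofFn fun s : Fin m => swap (atPosition σ s) (par (atPosition σ s))).reverse.prod

theorem sameCycle_turn_iff [DecidableEq V] [Finite V] (hm : 0 < m) (hG : G.IsAcyclic)
    (hpar : IsParentMap G (σ.symm 0) par) {v : V} :
    (turn σ par).SameCycle (σ.symm 0) v ↔ G.Reachable (σ.symm 0) v := by
  have h : turn σ par = (((List.ofFn fun s : Fin m => atPosition σ s).reverse).map
      fun u => swap u (par u)).prod := by
    rw [turn, List.map_reverse, List.map_ofFn]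
    rfl
  rw [h]
  refine hpar.sameCycle_prod_swap_iff hG ?_ fun v => ?_
  · rw [List.nodup_reverse, List.nodup_ofFn]
    intro s s' hs
    have := atPosition_inj hm σ hs
    rw [Nat.mod_eq_of_lt s.isLt, Nat.mod_eq_of_lt s'.isLt] at this
    exact Fin.ext this
  · rw [List.mem_reverse, List.mem_ofFn']
    constructor
    · rintro ⟨s, rfl⟩
      exact atPosition_ne hm σ s
    · intro hv
      obtain ⟨s, hs, h⟩ := exists_atPosition σ hv
      exact ⟨⟨s, hs⟩, h⟩

/-- After `k` full turns the active vertex has moved by the `k`-th power of `turn`. -/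
theorem slide_pow_mul_symm_zero [DecidableEq V] (hm : 0 < m) (hG : G.IsAcyclic)
    (hpar : IsParentMap G (σ.symm 0) par) (k : ℕ) :
    ((slide G m ^ (m * k)) σ).symm 0 = (turn σ par ^ k) (σ.symm 0) := by
  induction k with
  | zero => simp
  | succ k ih =>
    have h := prod_reverse_ofFn_apply
      (fun s => swap (atPosition σ s) (par (atPosition σ s)))
      (fun s => ((slide G m ^ (m * k + s)) σ).symm 0) m (by
        intro s _
        rw [← add_assoc, pow_succ', Perm.mul_apply,
          ((isCompatible_slide_pow hm hG hpar _).step hm hG hpar).2, ← atPosition_mod,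
          Nat.mul_add_mod, atPosition_mod])
    rw [mul_add, mul_one, ← h, pow_succ', Perm.mul_apply, ← ih]
    rfl

/-- The slides return to `σ` exactly after a number of full turns that is divisible by the length of
the cycle of the active vertex under `turn`, which is the size of its component. -/
theorem minimalPeriod_slide [Finite V] (hm : 0 < m) (hG : G.IsAcyclic)
    (σ : Labeling V (m + 1)) :
    Function.minimalPeriod (slide G m) σ =
      m * (G.connectedComponentMk (σ.symm 0)).supp.ncard := by
  classical
  obtain ⟨par, hpar⟩ := exists_isParentMap G (σ.symm 0)
  have ht : (G.connectedComponentMk (σ.symm 0)).supp.ncard =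
      Function.minimalPeriod (turn σ par) (σ.symm 0) := by
    rw [← ncard_sameCycle]
    congr 1
    ext v
    rw [Set.mem_ofPred_eq, sameCycle_turn_iff hm hG hpar,
      SimpleGraph.ConnectedComponent.mem_supp_iff,
      SimpleGraph.ConnectedComponent.eq, SimpleGraph.reachable_comm]
  rw [ht]
  -- A return to `σ` takes full turns only: after `k` slides the vertex with the second label is at
  -- position `k`, and by uniqueness only `atPosition σ k` can be there while the active vertex is
  -- the initial one.
  have hfix : ∀ k, (slide G m ^ k) σ = σ → k ≡ 0 [MOD m] := by
    intro k hk
    have h1 := (isCompatible_slide_pow hm hG hpar k).2 0 hm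
    rw [hk] at h1
    have h2 : Occupies G par (σ.symm 0) (atPosition σ k) (atPosition σ k) :=
      .initial hpar (atPosition_ne hm σ k)
    rw [zero_add] at h1
    have h3 := h1.unique hG h2
    refine (atPosition_inj hm σ (s := 0) ?_).symm
    rw [← h3, atPosition, Nat.zero_mod]
  have hiff : ∀ k, (slide G m ^ k) σ = σ ↔
      m * Function.minimalPeriod (turn σ par) (σ.symm 0) ∣ k := by
    intro k
    constructor
    · intro hk
      obtain ⟨q, rfl⟩ := (Nat.modEq_zero_iff_dvd).1 (hfix k hk)
      refine mul_dvd_mul_left m ?_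
      rw [← Function.isPeriodicPt_iff_minimalPeriod_dvd, Function.IsPeriodicPt,
        Function.IsFixedPt, ← Perm.coe_pow, ← slide_pow_mul_symm_zero hm hG hpar, hk]
    · rintro ⟨q, rfl⟩
      refine IsCompatible.unique (k := _) (k' := 0) hG ?_
        (isCompatible_slide_pow hm hG hpar _) (.zero hm hpar) ?_
      · rw [Nat.modEq_zero_iff_dvd, mul_assoc]
        exact dvd_mul_right _ _
      · rw [mul_assoc, slide_pow_mul_symm_zero hm hG hpar]
        have : Function.IsPeriodicPt (turn σ par)
            (Function.minimalPeriod (turn σ par) (σ.symm 0) * q) (σ.symm 0) :=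
          (Function.isPeriodicPt_minimalPeriod _ _).mul_const q
        rw [Perm.coe_pow]
        exact this
  refine eq_of_forall_dvd fun k => ?_
  rw [← hiff, ← Function.isPeriodicPt_iff_minimalPeriod_dvd, Perm.coe_pow]
  rfl

theorem ncard_toricOrbit [Finite V] (hm : 0 < m) (hG : G.IsAcyclic) (σ : Labeling V (m + 1)) :
    (toricOrbit G σ).ncard = m * ((G.connectedComponentMk (σ.symm 0)).supp.ncard /
      Nat.gcd (G.connectedComponentMk (σ.symm 0)).supp.ncard (m + 1)) := by
  have h : toricOrbit G σ = {τ | (toricPromotion G (m + 1)).SameCycle σ τ} := rfl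
  rw [h, ncard_sameCycle, toricPromotion_eq_slide_pow, Perm.coe_pow,
    Function.minimalPeriod_iterate_eq_div_gcd (Nat.succ_ne_zero m), minimalPeriod_slide hm hG,
    Nat.Coprime.gcd_mul_left_cancel _ (by simp), Nat.mul_div_assoc _ (Nat.gcd_dvd_left _ _)]

end Forest

end ToricPromotion

theorem theorem1p3 {V : Type*} [Fintype V] (n : ℕ) (hn : 2 ≤ n) (hV : Fintype.card V = n)
    (G : SimpleGraph V) :
    (G.IsAcyclic → ∀ σ : ToricPromotion.Labeling V n, ∀ t : ℕ,
      t = (G.connectedComponentMk (σ.symm ⟨0, by omega⟩)).supp.ncard →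
      (ToricPromotion.toricOrbit G σ).ncard = (n - 1) * (t / Nat.gcd t n)) ∧
    (G.IsTree → ∀ σ : ToricPromotion.Labeling V n,
      (ToricPromotion.toricOrbit G σ).ncard = n - 1) := by
  obtain ⟨m, rfl⟩ : ∃ m, n = m + 1 := ⟨n - 1, by omega⟩
  have hm : 0 < m := by omega
  refine ⟨fun hG σ t ht => ?_, fun hG σ => ?_⟩
  · rw [ht]
    exact ToricPromotion.ncard_toricOrbit hm hG σ
  · have hsupp : (G.connectedComponentMk (σ.symm 0)).supp = Set.univ := by
      refine Set.eq_univ_of_forall fun v => ?_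
      rw [SimpleGraph.ConnectedComponent.mem_supp_iff, SimpleGraph.ConnectedComponent.eq]
      exact hG.connected.preconnected v _
    rw [ToricPromotion.ncard_toricOrbit hm hG.isAcyclic σ, hsupp, Set.ncard_univ,
      Nat.card_eq_fintype_card, hV, Nat.gcd_self, Nat.div_self (Nat.succ_pos m), mul_one,
      Nat.add_sub_cancel]
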